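/- Let $\rho,\eta,\lambda,G>0$ be constants and $\Omega=(0,1)$. Consider the linear system $$\rho\,\partial_t u=\eta\,\partial_{yy}u+\partial_y\tau,\qquad \lambda\,\partial_t\tau=G\,\partial_y u\qquad (t>0,\ y\in\Omega),$$ with homogeneous Dirichlet boundary conditions $u(t,0)=u(t,1)=0$ for all $t\ge 0$. Then there is a constant $C>0$, depending only on $\rho,\eta,\lambda,G$ (in particular independent of time and of the initial data), such that every solution $$(u,\tau)\in\bigl(C([0,\infty);H^1(\Omega))\cap L^2_{loc}([0,\infty);H^2(\Omega))\bigr)\times C([0,\infty);H^1(\Omega))$$ (the time derivatives being understood in the sense of distributions on $(0,\infty)$ with values in $L^2(\Omega)$) converges exponentially fast in $H^1(\Omega)\times L^2(\Omega)$ to the steady state $(0,\overline{\tau_0})$, where $\tau_0=\tau(0,\cdot)$ and $\overline{\tau_0}=\int_0^1\tau_0(y)\,dy$. More precisely, for every such solution there is a constant $C_0$, independent of time, such that, for all sufficiently large $t$, $$\|u(t,\cdot)\|_{H^1}+\|\tau(t,\cdot)-\overline{\tau_0}\|_{L^2}\le C_0e^{-Ct} \quad\text{and}\quad \|\partial_y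 u(t,\cdot)\|_{L^2}+\|\tau(t,\cdot)-\overline{\tau_0}\|_{L^2}\le C_0e^{-Ct}.$$ -/

import Mathlib

open MeasureTheory Set
open scoped ContDiff

noncomputable section

namespace CouetteFlow

/-- Lebesgue measure on the space interval `Ω = (0, 1)`. -/
abbrev μΩ : Measure ℝ := volume.restrict (Ioo (0 : ℝ) 1)

/-- The real Hilbert space `L²(Ω)`. -/
abbrev L2 : Type := Lp ℝ 2 μΩ

/-- `φ ∈ C_c^∞(U)`. -/
def IsTest (U : Set ℝ) (φ : ℝ → ℝ) : Prop :=
  ContDiff ℝ ∞ φ ∧ HasCompactSupport φ ∧ tsupport φ ⊆ U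

/-- `g` is the weak derivative of `f` on `Ω`. -/
def IsWeakDeriv (f g : L2) : Prop :=
  ∀ φ : ℝ → ℝ, IsTest (Ioo 0 1) φ →
    ∫ y, f y * deriv φ y ∂μΩ = -∫ y, g y * φ y ∂μΩ

theorem integrable_mul_of_continuous (f : L2) {φ : ℝ → ℝ} (hφ : Continuous φ)
    (hc : HasCompactSupport φ) : Integrable (fun y => f y * φ y) μΩ :=
  (Lp.memLp f).integrable_mul (q := 2) (hφ.memLp_of_hasCompactSupport hc)

theorem IsTest.integrable_mul {U : Set ℝ} {φ : ℝ → ℝ} (hφ : IsTest U φ) (f : L2) :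
    Integrable (fun y => f y * φ y) μΩ :=
  integrable_mul_of_continuous f hφ.1.continuous hφ.2.1

theorem IsTest.integrable_mul_deriv {U : Set ℝ} {φ : ℝ → ℝ} (hφ : IsTest U φ) (f : L2) :
    Integrable (fun y => f y * deriv φ y) μΩ :=
  integrable_mul_of_continuous f (hφ.1.continuous_deriv (by simp)) hφ.2.1.deriv

theorem IsWeakDeriv.zero : IsWeakDeriv 0 0 := by
  intro φ _
  have h0 : ∀ ψ : ℝ → ℝ, ∫ y, (0 : L2) y * ψ y ∂μΩ = 0 := by
    intro ψ
    rw [integral_eq_zero_of_ae]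
    filter_upwards [Lp.coeFn_zero ℝ 2 μΩ] with y hy
    rw [hy]
    exact zero_mul (ψ y)
  rw [h0, h0, neg_zero]

theorem IsWeakDeriv.add {f g f' g' : L2} (h : IsWeakDeriv f g) (h' : IsWeakDeriv f' g') :
    IsWeakDeriv (f + f') (g + g') := by
  intro φ hφ
  have key : ∀ (a b : L2) (ψ : ℝ → ℝ), Integrable (fun y => a y * ψ y) μΩ →
      Integrable (fun y => b y * ψ y) μΩ →
      ∫ y, (a + b) y * ψ y ∂μΩ = ∫ y, a y * ψ y ∂μΩ + ∫ y, b y * ψ y ∂μΩ := by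
    intro a b ψ ha hb
    rw [← integral_add ha hb]
    refine integral_congr_ae ?_
    filter_upwards [Lp.coeFn_add a b] with y hy
    rw [hy, Pi.add_apply, add_mul]
  rw [key _ _ _ (hφ.integrable_mul_deriv f) (hφ.integrable_mul_deriv f'),
    key _ _ _ (hφ.integrable_mul g) (hφ.integrable_mul g'), h φ hφ, h' φ hφ, neg_add]

theorem IsWeakDeriv.smul {f g : L2} (c : ℝ) (h : IsWeakDeriv f g) :
    IsWeakDeriv (c • f) (c • g) := by
  intro φ hφ
  have key : ∀ (a : L2) (ψ : ℝ → ℝ),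
      ∫ y, (c • a) y * ψ y ∂μΩ = c * ∫ y, a y * ψ y ∂μΩ := by
    intro a ψ
    rw [← integral_const_mul]
    refine integral_congr_ae ?_
    filter_upwards [Lp.coeFn_smul c a] with y hy
    rw [hy, Pi.smul_apply, smul_eq_mul, mul_assoc]
  rw [key, key, h φ hφ, mul_neg]

/-- The Sobolev space `H¹(Ω)`, as the space of pairs `(f, f')` of an `L²` function and its weak
derivative in `L²`, with the Hilbert norm `‖f‖² + ‖f'‖²`. -/
def H1Sub : Submodule ℝ (WithLp 2 (L2 × L2)) where
  carrier := {p | IsWeakDeriv p.fst p.snd}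
  add_mem' h h' := IsWeakDeriv.add h h'
  zero_mem' := IsWeakDeriv.zero
  smul_mem' c _ h := IsWeakDeriv.smul c h

/-- `H¹(Ω)` as a type. -/
abbrev H1 : Type := H1Sub

/-- The underlying `L²` function. -/
def H1.fn (f : H1) : L2 := (f : WithLp 2 (L2 × L2)).fst

/-- The weak derivative `∂f/∂y`. -/
def H1.dy (f : H1) : L2 := (f : WithLp 2 (L2 × L2)).snd

/-- The Sobolev space `H²(Ω)`, as the space of pairs `(f, f'')` where `f ∈ H¹` and `f'' ∈ L²` is
the weak derivative of `f'`, with the Hilbert norm `‖f‖² + ‖f'‖² + ‖f''‖²`. -/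
def H2Sub : Submodule ℝ (WithLp 2 (H1 × L2)) where
  carrier := {p | IsWeakDeriv (H1.dy p.fst) p.snd}
  add_mem' h h' := IsWeakDeriv.add h h'
  zero_mem' := IsWeakDeriv.zero
  smul_mem' c _ h := IsWeakDeriv.smul c h

/-- `H²(Ω)` as a type. -/
abbrev H2 : Type := H2Sub

/-- The underlying `H¹` function. -/
def H2.toH1 (f : H2) : H1 := (f : WithLp 2 (H1 × L2)).fst

/-- The second weak derivative `∂²f/∂y²`. -/
def H2.dyy (f : H2) : L2 := (f : WithLp 2 (H1 × L2)).snd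

/-- `f(0) = f(1) = 0`, for the continuous representative of `f` on `[0, 1]`. -/
def H1.VanishesOnBoundary (f : H1) : Prop :=
  ∃ c : ℝ → ℝ, ContinuousOn c (Icc 0 1) ∧ (∀ᵐ y ∂μΩ, f.fn y = c y) ∧ c 0 = 0 ∧ c 1 = 0

/-- The average of `f` over `Ω`, an interval of length one. -/
def mean (f : L2) : ℝ := ∫ y, f y ∂μΩ

/-- `f - c`, for a constant `c`. -/
def subConst (f : L2) (c : ℝ) : L2 := f - Lp.const 2 μΩ c

/-- `∂v/∂t = w` on `(0, ∞)` in the sense of `L²(Ω)`-valued distributions. -/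
def HasWeakTimeDeriv (v w : ℝ → L2) : Prop :=
  ∀ φ : ℝ → ℝ, IsTest (Ioi 0) φ →
    ∫ t in Ioi (0 : ℝ), deriv φ t • v t = -∫ t in Ioi (0 : ℝ), φ t • w t

/-- `v` represents `u` in `L²_loc([0, ∞); H²)`. -/
def IsL2LocH2Lift (u : ℝ → H1) (v : ℝ → H2) : Prop :=
  (∀ T : ℝ, 0 < T → MemLp v 2 (volume.restrict (Icc 0 T))) ∧
    ∀ᵐ t ∂(volume.restrict (Ici (0 : ℝ))), (v t).toH1 = u t

/-- `(u, τ)` belongs to `(C([0,∞); H¹) ∩ L²_loc([0,∞); H²)) × C([0,∞); H¹)` and solves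
`ρ u_t = η u_yy + τ_y`, `λ τ_t = G u_y` with `u(t, 0) = u(t, 1) = 0`.
Only the values at times `t ≥ 0` matter. -/
structure IsSolution (ρ η lam G : ℝ) (u τ : ℝ → H1) : Prop where
  continuousOn_u : ContinuousOn u (Ici 0)
  continuousOn_τ : ContinuousOn τ (Ici 0)
  boundary : ∀ t : ℝ, 0 ≤ t → (u t).VanishesOnBoundary
  momentum : ∃ v : ℝ → H2, IsL2LocH2Lift u v ∧
    HasWeakTimeDeriv (fun t => ρ • (u t).fn) (fun t => η • (v t).dyy + (τ t).dy)
  stress : HasWeakTimeDeriv (fun t => lam • (τ t).fn) (fun t => G • (u t).dy)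

end CouetteFlow

end

namespace CouetteFlow

/-! Expand `∂_y u` and `τ` in the functions cos(kπy). With m = kπ, the coefficients A and B satisfy
A' = -(m²/ρ)(ηA + B) and B' = (G/λ)A, so the system splits into planar linear ODEs. For k = 0, the
Dirichlet condition gives A = 0, hence B is constant and equals the mean of `τ`; subtracting that
mean removes the mode.

For k ≥ 1 the decay must be uniform in k. Put W = ηA + B. W is damped at rate m²η/ρ ≥ π²η/ρ, and
when W is small B' is close to -(G/(λη))B. A Lyapunov function built from W², B² and a large
multiple of the energy ρA²/m² + (λ/G)B² makes this quantitative, with constants independent of m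
(`lyapunov_rate`, `exists_mode_decay`). Parseval (`hasSum_inner_cosC_sq`) sums the modes, and
Poincaré recovers `u` from `∂_y u`.

The ODEs come from the weak formulation by testing the momentum equation with sin(kπy). These
functions vanish at the endpoints, so no boundary values of `∂_y u` or `τ` appear. The resulting
right-hand sides are continuous in time, which makes the coefficients differentiable for t > 0. -/

/-! ### Test functions, primitives and weak derivatives on an interval. -/

/-- Integration by parts for a primitive of an integrable function. -/
theorem integral_primitive_mul_deriv {g φ : ℝ → ℝ} {a b : ℝ}
    (hg : IntervalIntegrable g volume a b) (hφ : ContDiff ℝ 1 φ) (c : ℝ) :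
    ∫ x in a..b, (c + ∫ t in a..x, g t) * deriv φ x =
      (c + ∫ t in a..b, g t) * φ b - c * φ a - ∫ x in a..b, g x * φ x := by
  have hG := hg.absolutelyContinuousOnInterval_intervalIntegral (c := a) left_mem_uIcc
  have hΦ : AbsolutelyContinuousOnInterval φ a b :=
    ContDiffOn.absolutelyContinuousOnInterval hφ.contDiffOn
  have hd : Continuous (deriv φ) := hφ.continuous_deriv (by simp)
  have h1 := hG.integral_mul_deriv_eq_deriv_mul hΦ
  have h2 : ∫ x in a..b, deriv φ x = φ b - φ a :=
    intervalIntegral.integral_deriv_eq_sub (fun x _ => hφ.differentiable (by simp) x)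
      (hd.intervalIntegrable _ _)
  have h3 : ∫ x in a..b, deriv (fun x => ∫ t in a..x, g t) x * φ x = ∫ x in a..b, g x * φ x := by
    refine intervalIntegral.integral_congr_ae ?_
    filter_upwards [hg.ae_hasDerivAt_integral] with x hx hxm
    rw [(hx (uIoc_subset_uIcc hxm) a left_mem_uIcc).deriv]
  have h4 : ∫ x in a..b, (c + ∫ t in a..x, g t) * deriv φ x =
      (∫ x in a..b, c * deriv φ x) + ∫ x in a..b, (∫ t in a..x, g t) * deriv φ x := by
    rw [← intervalIntegral.integral_add]
    · simp only [add_mul]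
    · exact (hd.const_mul c |>.intervalIntegrable _ _) |> fun h => by simpa using h
    · exact (hd.intervalIntegrable _ _).continuousOn_mul hG.continuousOn
  rw [h4, h1, h3, intervalIntegral.integral_const_mul, h2]
  simp
  ring

theorem exists_Icc_of_isCompact_subset_Ioo {K : Set ℝ} {a b : ℝ} (hab : a < b)
    (hK : IsCompact K) (h : K ⊆ Ioo a b) :
    ∃ c d, a < c ∧ c ≤ d ∧ d < b ∧ K ⊆ Icc c d := by
  rcases K.eq_empty_or_nonempty with rfl | hne
  · exact ⟨(a + b) / 2, (a + b) / 2, by linarith, le_rfl, by linarith, empty_subset _⟩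
  · obtain ⟨c, hc⟩ := hK.exists_isLeast hne
    obtain ⟨d, hd⟩ := hK.exists_isGreatest hne
    exact ⟨c, d, (h hc.1).1, hc.2 hd.1, (h hd.1).2, fun x hx => ⟨hc.2 hx, hd.2 hx⟩⟩

theorem IsTest.eq_zero {U : Set ℝ} {φ : ℝ → ℝ} (hφ : IsTest U φ) {x : ℝ} (hx : x ∉ U) :
    φ x = 0 :=
  image_eq_zero_of_notMem_tsupport fun h => hx (hφ.2.2 h)

theorem IsTest.contDiff_one {U : Set ℝ} {φ : ℝ → ℝ} (hφ : IsTest U φ) : ContDiff ℝ 1 φ :=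
  hφ.1.of_le (by exact_mod_cast le_top)

theorem IsTest.deriv {U : Set ℝ} {φ : ℝ → ℝ} (hφ : IsTest U φ) : IsTest U (deriv φ) :=
  ⟨(contDiff_infty_iff_deriv.1 hφ.1).2, hφ.2.1.deriv, tsupport_deriv_subset.trans hφ.2.2⟩

theorem IsTest.mono {U V : Set ℝ} {φ : ℝ → ℝ} (hφ : IsTest U φ) (h : U ⊆ V) : IsTest V φ :=
  ⟨hφ.1, hφ.2.1, hφ.2.2.trans h⟩

theorem hasDerivAt_primitive {φ : ℝ → ℝ} (hφ : Continuous φ) (a x : ℝ) :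
    HasDerivAt (fun x => ∫ t in a..x, φ t) (φ x) x :=
  intervalIntegral.integral_hasDerivAt_right (hφ.intervalIntegrable _ _)
    (hφ.stronglyMeasurableAtFilter _ _) hφ.continuousAt

/-- A test function of zero integral is the derivative of a test function. -/
theorem IsTest.primitive {φ : ℝ → ℝ} {a b : ℝ} (hab : a < b) (hφ : IsTest (Ioo a b) φ)
    (h0 : ∫ x in a..b, φ x = 0) : IsTest (Ioo a b) (fun x => ∫ t in a..x, φ t) := by
  have hc := hφ.1.continuous
  have hd := hasDerivAt_primitive hc a
  obtain ⟨c, d, hac, hcd, hdb, hK⟩ := exists_Icc_of_isCompact_subset_Ioo hab hφ.2.1 hφ.2.2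
  have hz : ∀ x, x ∉ Icc c d → φ x = 0 := fun x hx =>
    image_eq_zero_of_notMem_tsupport fun h => hx (hK h)
  have hsupp : Function.support (fun x => ∫ t in a..x, φ t) ⊆ Icc c d := by
    intro x hx
    by_contra hx'
    refine hx ?_
    rcases lt_or_ge x c with h | h
    · refine (intervalIntegral.integral_congr (g := fun _ => (0 : ℝ)) fun t ht => ?_).trans (by simp)
      have : t ≤ max a x := ht.2
      exact hz t fun h' => absurd h'.1 (by simp only [not_le]; exact this.trans_lt (max_lt hac h))
    · have h' : d < x := by
        by_contra h'
        exact hx' ⟨h, not_lt.1 h'⟩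
      change ∫ t in a..x, φ t = 0
      -- To the right of the support, the zero total integral makes the primitive vanish.
      rw [← intervalIntegral.integral_add_adjacent_intervals (hc.intervalIntegrable a b)
        (hc.intervalIntegrable b x), h0, zero_add]
      refine (intervalIntegral.integral_congr (g := fun _ => (0 : ℝ)) fun t ht => ?_).trans (by simp)
      have : min b x ≤ t := ht.1
      exact hz t fun h' => absurd h'.2 (by simp only [not_le]; exact (lt_min hdb ‹_›).trans_le this)
  have hts : tsupport (fun x => ∫ t in a..x, φ t) ⊆ Icc c d := closure_minimal hsupp isClosed_Icc
  refine ⟨contDiff_infty_iff_deriv.2 ⟨fun x => (hd x).differentiableAt, ?_⟩, ?_, ?_⟩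
  · rw [show _root_.deriv (fun x => ∫ t in a..x, φ t) = φ from funext fun x => (hd x).deriv]
    exact hφ.1
  · exact isCompact_Icc.of_isClosed_subset (isClosed_tsupport _) hts
  · exact hts.trans fun x hx => ⟨hac.trans_le hx.1, hx.2.trans_lt hdb⟩

theorem exists_isTest_integral_eq_one {a b : ℝ} (hab : a < b) :
    ∃ ψ, IsTest (Ioo a b) ψ ∧ ∫ x in a..b, ψ x = 1 := by
  let f : ContDiffBump ((a + b) / 2) := ⟨(b - a) / 8, (b - a) / 4, by linarith, by linarith⟩
  have hts : tsupport (f.normed volume) ⊆ Ioo a b := by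
    rw [f.tsupport_normed_eq, Real.closedBall_eq_Icc]
    intro x hx
    simp only [f, mem_Icc] at hx
    constructor <;> linarith [hx.1, hx.2]
  have ht : IsTest (Ioo a b) (f.normed volume) := ⟨f.contDiff_normed, f.hasCompactSupport_normed, hts⟩
  refine ⟨_, ht, ?_⟩
  rw [intervalIntegral.integral_of_le hab.le, integral_Ioc_eq_integral_Ioo,
    setIntegral_eq_integral_of_forall_compl_eq_zero fun x hx => ht.eq_zero hx]
  exact f.integral_normed

theorem setIntegral_Ioo_eq {a b : ℝ} (hab : a ≤ b) (f : ℝ → ℝ) :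
    ∫ x in Ioo a b, f x = ∫ x in a..b, f x := by
  rw [intervalIntegral.integral_of_le hab, integral_Ioc_eq_integral_Ioo]

theorem integrableOn_mul_of_continuous {f φ : ℝ → ℝ} {a b : ℝ} (hf : IntegrableOn f (Ioo a b))
    (hφ : Continuous φ) : IntegrableOn (fun x => f x * φ x) (Ioo a b) := by
  have := ((integrableOn_Icc_iff_integrableOn_Ioo (by simp) (by simp)).2 hf).mul_continuousOn hφ.continuousOn isCompact_Icc
  exact this.mono_set Ioo_subset_Icc_self

/-- Du Bois-Reymond: a function of zero weak derivative is constant. -/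
theorem ae_eq_const_of_weak_deriv_zero {h : ℝ → ℝ} {a b : ℝ} (hab : a < b)
    (hh : IntegrableOn h (Ioo a b))
    (H : ∀ φ, IsTest (Ioo a b) φ → ∫ x in Ioo a b, h x * deriv φ x = 0) :
    ∃ c, ∀ᵐ x ∂(volume.restrict (Ioo a b)), h x = c := by
  obtain ⟨ψ, hψ, hψ1⟩ := exists_isTest_integral_eq_one hab
  refine ⟨∫ x in Ioo a b, h x * ψ x, ?_⟩
  set c := ∫ x in Ioo a b, h x * ψ x with hc
  have hint : IntegrableOn (fun x => h x - c) (Ioo a b) :=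
    hh.sub (integrableOn_const (by simp))
  have key := isOpen_Ioo.ae_eq_zero_of_integral_contDiff_smul_eq_zero (f := fun x => h x - c)
    (μ := volume) (U := Ioo a b) hint.locallyIntegrableOn ?_
  · rw [ae_restrict_iff' measurableSet_Ioo]
    filter_upwards [key] with x hx hxm
    linarith [hx hxm]
  · intro χ h1 h2 h3
    have hχ : IsTest (Ioo a b) χ := ⟨h1, h2, h3⟩
    set m := ∫ x in a..b, χ x with hm
    -- Removing the multiple m of `ψ` leaves integral zero, so the result is the derivative of an
    -- admissible test function.
    have hθ : IsTest (Ioo a b) (fun x => χ x - m * ψ x) := by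
      refine ⟨h1.sub (contDiff_const.mul hψ.1), h2.sub (hψ.2.1.mul_left (f := fun _ => m)), ?_⟩
      refine (tsupport_sub _ _).trans (union_subset h3 ?_)
      exact (tsupport_mul_subset_right (f := fun _ => m)).trans hψ.2.2
    have hθ0 : ∫ x in a..b, (χ x - m * ψ x) = 0 := by
      rw [intervalIntegral.integral_sub (h1.continuous.intervalIntegrable _ _)
        ((hψ.1.continuous.const_mul m).intervalIntegrable _ _),
        intervalIntegral.integral_const_mul, hψ1, ← hm]
      ring
    have e := H _ (hθ.primitive hab hθ0)
    rw [show deriv (fun x => ∫ t in a..x, (χ t - m * ψ t)) = fun x => χ x - m * ψ x from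
      funext fun x => (hasDerivAt_primitive hθ.1.continuous a x).deriv] at e
    have i1 := integrableOn_mul_of_continuous hh h1.continuous
    have i2 := integrableOn_mul_of_continuous hh hψ.1.continuous
    have e2 : ∫ x in Ioo a b, h x * (χ x - m * ψ x) = (∫ x in Ioo a b, h x * χ x) - m * c := by
      rw [hc, ← integral_const_mul, ← integral_sub i1 (i2.const_mul m)]
      congr 1; ext x; ring
    rw [← setIntegral_eq_integral_of_forall_compl_eq_zero (s := Ioo a b)
      fun x hx => by simp [hχ.eq_zero hx]]
    have e3 : ∫ x in Ioo a b, χ x • (h x - c) = (∫ x in Ioo a b, h x * χ x) - c * m := by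
      rw [hm, ← setIntegral_Ioo_eq hab.le, ← integral_const_mul, ← integral_sub i1]
      · congr 1; ext x; simp only [smul_eq_mul]; ring
      · exact (h1.continuous.const_mul c).integrableOn_Icc.mono_set Ioo_subset_Icc_self
    rw [e3]; linarith

/-- A function with a weak derivative is almost everywhere a primitive of it. -/
theorem ae_eq_primitive_of_weak_deriv {f g : ℝ → ℝ} {a b : ℝ} (hab : a < b)
    (hf : IntegrableOn f (Ioo a b)) (hg : IntegrableOn g (Ioo a b))
    (H : ∀ φ, IsTest (Ioo a b) φ →
      ∫ x in Ioo a b, f x * deriv φ x = -∫ x in Ioo a b, g x * φ x) :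
    ∃ c, ∀ᵐ x ∂(volume.restrict (Ioo a b)), f x = c + ∫ t in a..x, g t := by
  have hg' : IntervalIntegrable g volume a b :=
    (intervalIntegrable_iff_integrableOn_Ioo_of_le hab.le).2 hg
  have hG : ContinuousOn (fun x => ∫ t in a..x, g t) (Icc a b) := by
    have := (hg'.absolutelyContinuousOnInterval_intervalIntegral (c := a) left_mem_uIcc).continuousOn
    rwa [uIcc_of_le hab.le] at this
  have hGi : IntegrableOn (fun x => ∫ t in a..x, g t) (Ioo a b) :=
    (hG.integrableOn_Icc).mono_set Ioo_subset_Icc_self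
  obtain ⟨c, hc⟩ := ae_eq_const_of_weak_deriv_zero (h := fun x => f x - ∫ t in a..x, g t) hab
    (hf.sub hGi) fun φ hφ => by
      have hd := hφ.deriv.1.continuous
      have := integral_primitive_mul_deriv hg' hφ.contDiff_one 0
      simp only [zero_add, hφ.eq_zero (right_notMem_Ioo), mul_zero, zero_mul, sub_zero,
        zero_sub] at this
      simp only [sub_mul]
      rw [integral_sub (integrableOn_mul_of_continuous hf hd)
        (integrableOn_mul_of_continuous hGi hd), H φ hφ, setIntegral_Ioo_eq hab.le,
        setIntegral_Ioo_eq hab.le, this]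
      ring
  exact ⟨c, hc.mono fun x hx => by linarith⟩

theorem eqOn_Icc_of_ae_eq {f g : ℝ → ℝ} {a b : ℝ} (hab : a < b) (hf : ContinuousOn f (Icc a b))
    (hg : ContinuousOn g (Icc a b)) (h : ∀ᵐ x ∂(volume.restrict (Ioo a b)), f x = g x) :
    EqOn f g (Icc a b) := by
  have h' : f =ᵐ[volume.restrict (Icc a b)] g := by
    rwa [Filter.EventuallyEq, ← restrict_Ioo_eq_restrict_Icc]
  exact Measure.eqOn_Icc_of_ae_eq volume hab.ne h' hf hg

/-! ### Weak time derivatives in integral form. -/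

theorem setIntegral_Ioi_eq_Ioo {E : Type*} [NormedAddCommGroup E] [NormedSpace ℝ E] {φ : ℝ → ℝ}
    {T : ℝ} (hφ : IsTest (Ioo 0 T) φ) (v : ℝ → E) :
    ∫ t in Ioi (0 : ℝ), φ t • v t = ∫ t in Ioo 0 T, φ t • v t :=
  setIntegral_eq_of_subset_of_forall_sdiff_eq_zero (f := fun t => φ t • v t) measurableSet_Ioi
    (fun _ hx => mem_Ioi.2 hx.1) fun x hx => by rw [hφ.eq_zero hx.2, zero_smul]

/-- A continuous curve with a locally integrable weak time derivative satisfies the integral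
equation, componentwise. -/
theorem HasWeakTimeDeriv.inner_eq {v w : ℝ → L2} (h : HasWeakTimeDeriv v w)
    (hv : ContinuousOn v (Ici 0)) (hw : ∀ T, 0 < T → IntegrableOn w (Icc 0 T)) (e : L2) {t : ℝ}
    (ht : 0 ≤ t) :
    inner ℝ e (v t) = inner ℝ e (v 0) + ∫ s in (0 : ℝ)..t, inner ℝ e (w s) := by
  rcases ht.eq_or_lt with rfl | ht
  · simp
  have hvi : ∀ T, 0 < T → IntegrableOn v (Icc 0 T) := fun T _ =>
    (hv.mono Icc_subset_Ici_self).integrableOn_Icc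
  have hinner : ∀ (T : ℝ) (φ : ℝ → ℝ) (z : ℝ → L2), IsTest (Ioo 0 T) φ →
      IntegrableOn z (Icc 0 T) →
      inner ℝ e (∫ s in Ioi (0 : ℝ), φ s • z s) = ∫ s in Ioo 0 T, inner ℝ e (z s) * φ s := by
    intro T φ z hφ hz
    have hi : IntegrableOn (fun s => φ s • z s) (Ioo 0 T) :=
      (hz.continuousOn_smul hφ.1.continuous.continuousOn isCompact_Icc).mono_set
        Ioo_subset_Icc_self
    rw [setIntegral_Ioi_eq_Ioo hφ, ← integral_inner hi]
    simp only [inner_smul_right, mul_comm]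
  have hw' : IntegrableOn (fun s => inner ℝ e (w s)) (Icc 0 t) := (hw t ht).const_inner e
  have hc : ContinuousOn (fun s => inner ℝ e (v s)) (Icc 0 t) :=
    continuousOn_const.inner (hv.mono Icc_subset_Ici_self)
  obtain ⟨c, hc'⟩ := ae_eq_primitive_of_weak_deriv (f := fun s => inner ℝ e (v s))
    (g := fun s => inner ℝ e (w s)) ht
    (IntegrableOn.mono_set ((hvi t ht).const_inner e) Ioo_subset_Icc_self) (hw'.mono_set Ioo_subset_Icc_self)
    fun φ hφ => by
      have := congrArg (inner ℝ e) (h φ (hφ.mono fun x hx => hx.1))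
      rwa [inner_neg_right, hinner t _ _ hφ.deriv (hvi t ht), hinner t _ _ hφ (hw t ht)] at this
  have hprim : ContinuousOn (fun s => c + ∫ r in (0 : ℝ)..s, inner ℝ e (w r)) (Icc 0 t) := by
    refine continuousOn_const.add ?_
    have := intervalIntegral.continuousOn_primitive_interval (μ := volume) (a := 0) (b := t)
      (f := fun s => inner ℝ e (w s)) (by rwa [uIcc_of_le ht.le])
    rwa [uIcc_of_le ht.le] at this
  -- Continuity upgrades the a.e. identity to all of [0, t]; the endpoint 0 then identifies the
  -- constant.
  have heq := eqOn_Icc_of_ae_eq ht hc hprim hc'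
  have h0 := heq (left_mem_Icc.2 ht.le)
  have h1 := heq (right_mem_Icc.2 ht.le)
  simp only [intervalIntegral.integral_same, add_zero] at h0 h1
  rw [h1, h0]

/-! ### Primitives, boundary values and the Poincaré inequality in H¹(0,1). -/

theorem L2.integrableOn (f : L2) : IntegrableOn f (Ioo (0 : ℝ) 1) :=
  (Lp.memLp f).integrable (by norm_num)

theorem L2.intervalIntegrable (f : L2) : IntervalIntegrable f volume 0 1 :=
  (intervalIntegrable_iff_integrableOn_Ioo_of_le zero_le_one).2 f.integrableOn

theorem H1.exists_primitive (f : H1) :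
    ∃ c, ∀ᵐ y ∂μΩ, f.fn y = c + ∫ t in (0 : ℝ)..y, f.dy t :=
  ae_eq_primitive_of_weak_deriv zero_lt_one f.fn.integrableOn f.dy.integrableOn f.2

theorem H1.integral_fn_mul_deriv {f : H1} {c : ℝ}
    (hc : ∀ᵐ y ∂μΩ, f.fn y = c + ∫ t in (0 : ℝ)..y, f.dy t) {φ : ℝ → ℝ} (hφ : ContDiff ℝ 1 φ) :
    ∫ y, f.fn y * deriv φ y ∂μΩ =
      (c + ∫ t in (0 : ℝ)..1, f.dy t) * φ 1 - c * φ 0 - ∫ y, f.dy y * φ y ∂μΩ := by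
  rw [setIntegral_Ioo_eq zero_le_one (fun y => f.dy y * φ y),
    ← integral_primitive_mul_deriv f.dy.intervalIntegrable hφ c, ← setIntegral_Ioo_eq zero_le_one]
  exact integral_congr_ae (hc.mono fun y hy => by simp only [hy])

/-- Integration by parts against a function vanishing on the boundary. -/
theorem H1.integral_dy_mul (f : H1) {φ : ℝ → ℝ} (hφ : ContDiff ℝ 1 φ) (h0 : φ 0 = 0)
    (h1 : φ 1 = 0) : ∫ y, f.dy y * φ y ∂μΩ = -∫ y, f.fn y * deriv φ y ∂μΩ := by
  obtain ⟨c, hc⟩ := f.exists_primitive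
  rw [H1.integral_fn_mul_deriv hc hφ, h0, h1]
  ring

theorem L2.continuousOn_primitive (f : L2) :
    ContinuousOn (fun y => ∫ t in (0 : ℝ)..y, f t) (Icc 0 1) := by
  have := (f.intervalIntegrable.absolutelyContinuousOnInterval_intervalIntegral (c := 0)
    left_mem_uIcc).continuousOn
  rwa [uIcc_of_le zero_le_one] at this

/-- The primitive of the weak derivative and the representative vanishing at the endpoints are both
continuous and agree a.e., hence everywhere on [0, 1]. Evaluation at 0 and 1 gives the two claims.
-/
theorem H1.VanishesOnBoundary.primitive {f : H1} (hf : f.VanishesOnBoundary) :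
    (∀ᵐ y ∂μΩ, f.fn y = 0 + ∫ t in (0 : ℝ)..y, f.dy t) ∧ ∫ t in (0 : ℝ)..1, f.dy t = 0 := by
  obtain ⟨c, hc⟩ := f.exists_primitive
  obtain ⟨r, hr, hfr, h0, h1⟩ := hf
  have heq := eqOn_Icc_of_ae_eq (g := fun y => c + ∫ t in (0 : ℝ)..y, f.dy t) zero_lt_one hr
    (continuousOn_const.add f.dy.continuousOn_primitive) (by
      filter_upwards [hc, hfr] with y h1 h2
      rw [← h2, h1])
  have e0 := heq (left_mem_Icc.2 zero_le_one)
  have e1 := heq (right_mem_Icc.2 zero_le_one)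
  simp only [intervalIntegral.integral_same, add_zero, h0, h1] at e0 e1
  subst e0
  exact ⟨hc, by linarith⟩

/-- Integration by parts for a function vanishing on the boundary. -/
theorem H1.VanishesOnBoundary.integral_dy_mul {f : H1} (hf : f.VanishesOnBoundary) {φ : ℝ → ℝ}
    (hφ : ContDiff ℝ 1 φ) : ∫ y, f.dy y * φ y ∂μΩ = -∫ y, f.fn y * deriv φ y ∂μΩ := by
  rw [H1.integral_fn_mul_deriv hf.primitive.1 hφ, hf.primitive.2]
  ring

instance : IsProbabilityMeasure μΩ := ⟨by simp⟩

/-- The Poincaré inequality. -/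
theorem H1.VanishesOnBoundary.norm_fn_le {f : H1} (hf : f.VanishesOnBoundary) :
    ‖f.fn‖ ≤ ‖f.dy‖ := by
  have h1 : ∫ y, ‖f.dy y‖ ∂μΩ ≤ ‖f.dy‖ := by
    rw [integral_norm_eq_lintegral_enorm (Lp.aestronglyMeasurable _), Lp.norm_def,
      ← eLpNorm_one_eq_lintegral_enorm]
    exact ENNReal.toReal_mono (Lp.eLpNorm_ne_top _)
      (eLpNorm_le_eLpNorm_of_exponent_le (by norm_num) (Lp.aestronglyMeasurable _))
  have h2 : ∀ᵐ y ∂μΩ, ‖f.fn y‖ ≤ ‖f.dy‖ := by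
    filter_upwards [hf.primitive.1, ae_restrict_mem measurableSet_Ioo] with y hy hym
    rw [hy, zero_add]
    refine (intervalIntegral.norm_integral_le_integral_norm hym.1.le).trans (le_trans ?_ h1)
    rw [intervalIntegral.integral_of_le hym.1.le]
    refine setIntegral_mono_set (L2.integrableOn f.dy).norm
      (Filter.Eventually.of_forall fun _ => norm_nonneg _) ?_
    exact LE.le.eventuallyLE fun x hx => ⟨hx.1, hx.2.trans_lt hym.2⟩
  have hμ : measureUnivNNReal μΩ = 1 := by simp [measureUnivNNReal]
  simpa [hμ] using Lp.norm_le_of_ae_bound (norm_nonneg _) h2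

/-! ### The cosine system in L²(Ω): orthogonality, completeness, Parseval. -/

theorem Continuous.memLp_μΩ {φ : ℝ → ℝ} (hφ : Continuous φ) : MemLp φ 2 μΩ := by
  obtain ⟨C, hC⟩ := isCompact_Icc.exists_bound_of_continuousOn (hφ.continuousOn (s := Icc (0 : ℝ) 1))
  refine MemLp.of_bound hφ.aestronglyMeasurable C ?_
  filter_upwards [ae_restrict_mem measurableSet_Ioo] with y hy
  exact hC y (Ioo_subset_Icc_self hy)

/-- A continuous function as an element of `L²(Ω)`. -/
noncomputable def contL2 (φ : C(ℝ, ℝ)) : L2 := (Continuous.memLp_μΩ φ.continuous).toLp φ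

theorem coeFn_contL2 (φ : C(ℝ, ℝ)) : contL2 φ =ᵐ[μΩ] φ := MemLp.coeFn_toLp _

theorem inner_contL2 (φ : C(ℝ, ℝ)) (f : L2) :
    inner ℝ (contL2 φ) f = ∫ y, f y * φ y ∂μΩ := by
  rw [L2.inner_def]
  refine integral_congr_ae ?_
  filter_upwards [coeFn_contL2 φ] with y hy
  simp [hy]

theorem inner_contL2_contL2 (φ ψ : C(ℝ, ℝ)) :
    inner ℝ (contL2 φ) (contL2 ψ) = ∫ y in (0 : ℝ)..1, ψ y * φ y := by
  rw [inner_contL2, ← setIntegral_Ioo_eq zero_le_one]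
  refine integral_congr_ae ?_
  filter_upwards [coeFn_contL2 ψ] with y hy
  rw [hy]

theorem contL2_add (φ ψ : C(ℝ, ℝ)) : contL2 (φ + ψ) = contL2 φ + contL2 ψ := rfl

theorem contL2_smul (c : ℝ) (φ : C(ℝ, ℝ)) : contL2 (c • φ) = c • contL2 φ := rfl

/-- `contL2` as a linear map. -/
noncomputable def contL2ₗ : C(ℝ, ℝ) →ₗ[ℝ] L2 where
  toFun := contL2
  map_add' := contL2_add
  map_smul' := contL2_smul

/-- The function `y ↦ cos (k π y)`. -/
noncomputable def cosC (k : ℕ) : C(ℝ, ℝ) := ⟨fun y => Real.cos (k * Real.pi * y), by fun_prop⟩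

/-- The function `y ↦ sin (k π y)`. -/
noncomputable def sinC (k : ℕ) : C(ℝ, ℝ) := ⟨fun y => Real.sin (k * Real.pi * y), by fun_prop⟩

theorem integral_cos_int_mul_pi (n : ℤ) :
    ∫ y in (0 : ℝ)..1, Real.cos (n * Real.pi * y) = if n = 0 then 1 else 0 := by
  split_ifs with h
  · simp [h]
  · have hn : (n * Real.pi : ℝ) ≠ 0 := mul_ne_zero (by exact_mod_cast h) Real.pi_ne_zero
    rw [intervalIntegral.integral_comp_mul_left (f := Real.cos) hn]
    simp [Real.sin_int_mul_pi]

/-- Product-to-sum formula. Two indicators are needed because both fire when j = k = 0, where the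
squared norm is 1 instead of 1/2. -/
theorem inner_cosC (j k : ℕ) : inner ℝ (contL2 (cosC j)) (contL2 (cosC k)) =
    ((if (k : ℤ) - j = 0 then 1 else 0) + (if (k : ℤ) + j = 0 then 1 else 0)) / 2 := by
  rw [inner_contL2_contL2, ← integral_cos_int_mul_pi, ← integral_cos_int_mul_pi,
    ← intervalIntegral.integral_add, ← intervalIntegral.integral_div]
  · congr 1
    ext y
    simp only [cosC, ContinuousMap.coe_mk]
    push_cast
    rw [sub_mul, sub_mul, add_mul, add_mul, Real.cos_sub, Real.cos_add]
    ring
  · exact Continuous.intervalIntegrable (by fun_prop) _ _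
  · exact Continuous.intervalIntegrable (by fun_prop) _ _

theorem contL2_cosC_ne_zero (k : ℕ) : contL2 (cosC k) ≠ 0 := by
  intro h
  have := inner_cosC k k
  rw [h, inner_zero_left] at this
  simp only [sub_self, if_true] at this
  split_ifs at this <;> norm_num at this

theorem inner_cosC_of_ne {j k : ℕ} (h : j ≠ k) :
    inner ℝ (contL2 (cosC j)) (contL2 (cosC k)) = 0 := by
  rw [inner_cosC, if_neg (by omega), if_neg (by omega)]
  norm_num

/-- The product-to-sum formula lowers the index by one, so index 0 is treated apart. This is the
induction step that puts every polynomial in cos(πy) into the cosine span. -/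
theorem cosC_mul_cosC_one_mem (k : ℕ) : cosC k * cosC 1 ∈ Submodule.span ℝ (range cosC) := by
  have mem : ∀ j, cosC j ∈ Submodule.span ℝ (range cosC) := fun j => Submodule.subset_span ⟨j, rfl⟩
  rcases k with _ | k
  · convert mem 1 using 1
    ext y
    simp [cosC]
  · have : cosC (k + 1) * cosC 1 = (1 / 2 : ℝ) • (cosC (k + 2) + cosC k) := by
      ext y
      simp only [cosC, ContinuousMap.mul_apply, ContinuousMap.coe_mk, ContinuousMap.smul_apply,
        ContinuousMap.add_apply, smul_eq_mul]
      have e1 : ((k + 2 : ℕ) : ℝ) * Real.pi * y =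
        ((k + 1 : ℕ) : ℝ) * Real.pi * y + ((1 : ℕ) : ℝ) * Real.pi * y := by push_cast; ring
      have e2 : (k : ℝ) * Real.pi * y =
        ((k + 1 : ℕ) : ℝ) * Real.pi * y - ((1 : ℕ) : ℝ) * Real.pi * y := by push_cast; ring
      rw [e1, e2, Real.cos_add, Real.cos_sub]
      ring
    rw [this]
    exact Submodule.smul_mem _ _ (Submodule.add_mem _ (mem _) (mem _))

theorem cosC_one_pow_mem (n : ℕ) : cosC 1 ^ n ∈ Submodule.span ℝ (range cosC) := by
  induction n with
  | zero =>
    have : (cosC 1 ^ 0) = cosC 0 := by ext y; simp [cosC]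
    rw [this]
    exact Submodule.subset_span ⟨0, rfl⟩
  | succ n ih =>
    rw [pow_succ]
    generalize cosC 1 ^ n = x at ih ⊢
    induction ih using Submodule.span_induction with
    | mem x hx => obtain ⟨k, rfl⟩ := hx; exact cosC_mul_cosC_one_mem k
    | zero => simp
    | add x y _ _ hx hy => rw [add_mul]; exact Submodule.add_mem _ hx hy
    | smul c x _ hx => rw [smul_mul_assoc]; exact Submodule.smul_mem _ _ hx

theorem aeval_cosC_one_mem (p : Polynomial ℝ) :
    Polynomial.aeval (cosC 1) p ∈ Submodule.span ℝ (range cosC) := by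
  rw [Polynomial.aeval_eq_sum_range]
  exact Submodule.sum_mem _ fun i _ => Submodule.smul_mem _ _ (cosC_one_pow_mem i)

/-- Cosine polynomials approximate continuous functions uniformly on `[0, 1]`. -/
theorem exists_span_cosC_near {g : ℝ → ℝ} (hg : Continuous g) {ε : ℝ} (hε : 0 < ε) :
    ∃ q ∈ Submodule.span ℝ (range cosC), ∀ y ∈ Icc (0 : ℝ) 1, |q y - g y| < ε := by
  -- The substitution x = cos(πy) maps [0, 1] bijectively to [-1, 1] and reduces the claim to
  -- Weierstrass approximation.
  obtain ⟨p, hp⟩ := exists_polynomial_near_of_continuousOn (-1) 1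
    (fun x => g (Real.arccos x / Real.pi)) (by fun_prop) ε hε
  refine ⟨_, aeval_cosC_one_mem p, fun y hy => ?_⟩
  have h1 := hp (Real.cos (Real.pi * y)) ⟨Real.neg_one_le_cos _, Real.cos_le_one _⟩
  rw [Real.arccos_cos (mul_nonneg Real.pi_pos.le hy.1)
    (mul_le_of_le_one_right Real.pi_pos.le hy.2), mul_div_cancel_left₀ _ Real.pi_ne_zero] at h1
  have h2 : (Polynomial.aeval (cosC 1) p) y = p.eval (Real.cos (Real.pi * y)) := by
    have := Polynomial.aeval_algHom_apply (ContinuousMap.evalAlgHom ℝ ℝ y) (cosC 1) p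
    simp only [ContinuousMap.evalAlgHom_apply] at this
    rw [← this]
    simp [cosC]
  rwa [h2]

/-- The cosine functions are complete in `L²(Ω)`. -/
theorem top_le_closure_span_cosC :
    ⊤ ≤ (Submodule.span ℝ (range fun k => contL2 (cosC k))).topologicalClosure := by
  have hspan : Submodule.span ℝ (range fun k => contL2 (cosC k)) =
      (Submodule.span ℝ (range cosC)).map contL2ₗ := by
    rw [Submodule.map_span, ← range_comp]
    rfl
  intro f _
  rw [← SetLike.mem_coe, Submodule.topologicalClosure_coe, Metric.mem_closure_iff]
  intro ε hε
  obtain ⟨g, hg, hgm⟩ := (Lp.memLp f).exists_boundedContinuous_eLpNorm_sub_le (by norm_num)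
    (ε := ENNReal.ofReal (ε / 2)) (by simpa using hε)
  obtain ⟨q, hq, hqg⟩ := exists_span_cosC_near g.continuous (ε := ε / 3) (by positivity)
  refine ⟨contL2 q, by rw [hspan]; exact ⟨q, hq, rfl⟩, ?_⟩
  have h1 : ‖f - contL2 g.toContinuousMap‖ ≤ ε / 2 := by
    rw [Lp.norm_def]
    refine ENNReal.toReal_le_of_le_ofReal (by positivity) (le_trans (le_of_eq ?_) hg)
    refine eLpNorm_congr_ae ?_
    filter_upwards [Lp.coeFn_sub f (contL2 g.toContinuousMap), coeFn_contL2 g.toContinuousMap]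
      with y h1 h2
    rw [h1, Pi.sub_apply, h2]
    rfl
  have h2 : ‖contL2 g.toContinuousMap - contL2 q‖ ≤ ε / 3 := by
    have : ∀ᵐ y ∂μΩ, ‖(contL2 g.toContinuousMap - contL2 q) y‖ ≤ ε / 3 := by
      filter_upwards [Lp.coeFn_sub (contL2 g.toContinuousMap) (contL2 q),
        coeFn_contL2 g.toContinuousMap, coeFn_contL2 q, ae_restrict_mem measurableSet_Ioo]
        with y h1 h2 h3 hy
      rw [h1, Pi.sub_apply, h2, h3, norm_sub_rev]
      exact (hqg y (Ioo_subset_Icc_self hy)).le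
    have hμ : measureUnivNNReal μΩ = 1 := by simp [measureUnivNNReal]
    simpa [hμ] using Lp.norm_le_of_ae_bound (by positivity) this
  rw [dist_eq_norm]
  calc ‖f - contL2 q‖ = ‖(f - contL2 g.toContinuousMap) + (contL2 g.toContinuousMap - contL2 q)‖ := by
        congr 1; abel
    _ ≤ ε / 2 + ε / 3 := (norm_add_le _ _).trans (add_le_add h1 h2)
    _ < ε := by linarith

/-- Parseval's identity for the cosine system. -/
theorem hasSum_inner_cosC_sq (f : L2) :
    HasSum (fun k => (‖contL2 (cosC k)‖⁻¹) ^ 2 * inner ℝ (contL2 (cosC k)) f ^ 2) (‖f‖ ^ 2) := by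
  set e : ℕ → L2 := fun k => ‖contL2 (cosC k)‖⁻¹ • contL2 (cosC k) with he
  have ho : Orthonormal ℝ e := by
    refine ⟨fun k => norm_smul_inv_norm (𝕜 := ℝ) (contL2_cosC_ne_zero k), fun j k hjk => ?_⟩
    simp only [he, inner_smul_left, inner_smul_right, inner_cosC_of_ne hjk, mul_zero]
  have hsp : Submodule.span ℝ (range fun k => contL2 (cosC k)) ≤ Submodule.span ℝ (range e) := by
    rw [Submodule.span_le]
    rintro _ ⟨k, rfl⟩
    have : contL2 (cosC k) = ‖contL2 (cosC k)‖ • e k := by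
      simp only [he]
      rw [smul_smul, mul_inv_cancel₀ (norm_ne_zero_iff.2 (contL2_cosC_ne_zero k)), one_smul]
    change contL2 (cosC k) ∈ _
    rw [this]
    exact Submodule.smul_mem _ _ (Submodule.subset_span ⟨k, rfl⟩)
  let b := HilbertBasis.mk ho (top_le_closure_span_cosC.trans (Submodule.topologicalClosure_mono hsp))
  have := b.hasSum_inner_mul_inner f f
  rw [real_inner_self_eq_norm_sq] at this
  convert! this using 1
  ext k
  simp only [b, HilbertBasis.coe_mk, he, inner_smul_left, inner_smul_right]
  rw [real_inner_comm f]
  simp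
  ring

/-- Parseval with the same positive weights on both sides transfers a modewise bound with uniform
constant to the norms. -/
theorem norm_sq_add_le_of_inner_cosC {f f' g g' : L2} {M : ℝ}
    (h : ∀ k, inner ℝ (contL2 (cosC k)) f ^ 2 + inner ℝ (contL2 (cosC k)) f' ^ 2 ≤
      M * (inner ℝ (contL2 (cosC k)) g ^ 2 + inner ℝ (contL2 (cosC k)) g' ^ 2)) :
    ‖f‖ ^ 2 + ‖f'‖ ^ 2 ≤ M * (‖g‖ ^ 2 + ‖g'‖ ^ 2) := by
  refine hasSum_le (fun k => ?_) ((hasSum_inner_cosC_sq f).add (hasSum_inner_cosC_sq f'))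
    (((hasSum_inner_cosC_sq g).add (hasSum_inner_cosC_sq g')).mul_left M)
  have := mul_le_mul_of_nonneg_left (h k) (sq_nonneg ‖contL2 (cosC k)‖⁻¹)
  linarith

/-! ### Lyapunov decay of a single mode. -/

/-- Exponential decay from a differential inequality. -/
theorem le_exp_mul_of_deriv_le {V V' : ℝ → ℝ} {c : ℝ} (hV : ContinuousOn V (Ici 0))
    (hd : ∀ t, 0 < t → HasDerivAt V (V' t) t) (h : ∀ t, 0 < t → V' t ≤ -c * V t) {t : ℝ}
    (ht : 0 ≤ t) : V t ≤ Real.exp (-c * t) * V 0 := by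
  have hanti : AntitoneOn (fun t => Real.exp (c * t) * V t) (Ici 0) := by
    have hder : ∀ s, 0 < s → HasDerivAt (fun t => Real.exp (c * t) * V t)
        (Real.exp (c * s) * (c * 1) * V s + Real.exp (c * s) * V' s) s := fun s hs =>
      (((hasDerivAt_id s).const_mul c).exp).mul (hd s hs)
    refine antitoneOn_of_deriv_nonpos (convex_Ici 0) ?_ ?_ ?_
    · exact ContinuousOn.mul (by fun_prop) hV
    · rw [interior_Ici]
      exact fun s hs => (hder s hs).differentiableAt.differentiableWithinAt
    · rw [interior_Ici]
      intro s hs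
      rw [(hder s hs).deriv]
      have := mul_le_mul_of_nonneg_left (h s hs) (Real.exp_pos (c * s)).le
      linarith
  have := hanti self_mem_Ici ht ht
  simp only [mul_zero, Real.exp_zero, one_mul] at this
  calc V t = Real.exp (-c * t) * (Real.exp (c * t) * V t) := by
        rw [← mul_assoc, ← Real.exp_add]; simp
    _ ≤ _ := mul_le_mul_of_nonneg_left this (Real.exp_pos _).le

theorem hasDerivAt_of_integral_eq {p q : ℝ → ℝ} (hq : ContinuousOn q (Ici 0))
    (h : ∀ t, 0 ≤ t → p t = p 0 + ∫ s in (0 : ℝ)..t, q s) {t : ℝ} (ht : 0 < t) :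
    HasDerivAt p (q t) t := by
  have h1 : HasDerivAt (fun t => p 0 + ∫ s in (0 : ℝ)..t, q s) (q t) t := by
    refine HasDerivAt.const_add _ (intervalIntegral.integral_hasDerivAt_right ?_ ?_ ?_)
    · exact ContinuousOn.intervalIntegrable (hq.mono (by
        rw [uIcc_of_le ht.le]; exact Icc_subset_Ici_self))
    · exact (hq.mono Ioi_subset_Ici_self).stronglyMeasurableAtFilter isOpen_Ioi t ht
    · exact hq.continuousAt (Ici_mem_nhds ht)
  refine h1.congr_of_eventuallyEq ?_
  filter_upwards [Ioi_mem_nhds ht] with s hs using h s (le_of_lt hs)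

/-- The quadratic inequality behind the decay of the Lyapunov function, with `W = η A + B`. -/
theorem lyapunov_rate {g κ κ₀ N W B : ℝ} (hg : 0 < g) (hκ₀ : 0 < κ₀) (hκ : κ₀ ≤ κ)
    (hN : N = 1 + 4 * g / κ₀) :
    -κ * W ^ 2 + g * W ^ 2 - g * B ^ 2 - g * (N + 1) * (W - B) ^ 2 ≤
      -(κ₀ / 2) * W ^ 2 - (g / 2) * (W - B) ^ 2 := by
  have hN1 : 1 ≤ N := by rw [hN]; linarith [div_pos (mul_pos four_pos hg) hκ₀]
  have hNκ : 4 * g ≤ N * κ₀ := by rw [hN, add_mul, div_mul_cancel₀ _ hκ₀.ne']; linarith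
  have h1 : 0 ≤ (κ - κ₀) * W ^ 2 := mul_nonneg (by linarith) (sq_nonneg _)
  -- With D = W - B, the factor N allows completing the square in N·D against W + B = 2W - D. The
  -- leftover (2W - D)² equals 8W² + 2D² - (2W + D)², which is absorbed thanks to 4g ≤ Nκ₀ and N ≥
  -- 1.
  have h2 : 0 ≤ N * (-g * W ^ 2 + g * B ^ 2 + g * N * (W - B) ^ 2 + κ₀ / 2 * W ^ 2
      + g / 2 * (W - B) ^ 2) := by
    have e1 := mul_nonneg hg.le (sq_nonneg (2 * N * (W - B) - (W + B)))
    have e2 := mul_nonneg hg.le (sq_nonneg (2 * W + (W - B)))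
    have e3 := mul_nonneg (sub_nonneg.2 hNκ) (sq_nonneg W)
    have e4 := mul_nonneg (mul_nonneg hg.le (sub_nonneg.2 hN1)) (sq_nonneg (W - B))
    linarith
  have h3 := nonneg_of_mul_nonneg_right h2 (by linarith)
  linarith

/-- Uniform exponential decay of all modes of the Couette system. -/
theorem exists_mode_decay {ρ η lam G : ℝ} (hρ : 0 < ρ) (hη : 0 < η) (hlam : 0 < lam)
    (hG : 0 < G) : ∃ c K : ℝ, 0 < c ∧ 0 ≤ K ∧ ∀ (m : ℝ) (A B : ℝ → ℝ), Real.pi ≤ m →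
      ContinuousOn A (Ici 0) → ContinuousOn B (Ici 0) →
      (∀ t, 0 < t → HasDerivAt A (-(m ^ 2 / ρ) * (η * A t + B t)) t) →
      (∀ t, 0 < t → HasDerivAt B (G / lam * A t) t) →
      ∀ t, 0 ≤ t → A t ^ 2 + B t ^ 2 ≤ K * Real.exp (-c * t) * (A 0 ^ 2 + B 0 ^ 2) := by
  have hπ := Real.pi_pos
  set g := G / (lam * η) with hg
  set κ₀ := Real.pi ^ 2 * η / ρ with hκ₀
  have hg0 : 0 < g := by positivity
  have hκ0 : 0 < κ₀ := by positivity
  obtain ⟨N, hN⟩ : ∃ N, N = 1 + 4 * g / κ₀ := ⟨_, rfl⟩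
  have hN0 : 0 < N := by rw [hN]; positivity
  -- The energy dissipates ηA², so this weight yields exactly the term g(N + 1)(ηA)² required by
  -- `lyapunov_rate`.
  obtain ⟨M, hM⟩ : ∃ M, M = η * g * (N + 1) := ⟨_, rfl⟩
  have hM0 : 0 < M := by rw [hM]; positivity
  obtain ⟨δ, hδ0, hδ⟩ : ∃ δ : ℝ, 0 < δ ∧ ∀ A B : ℝ, δ * (A ^ 2 + B ^ 2) ≤
      (κ₀ / 2) * (η * A + B) ^ 2 + (g / 2) * (η * A) ^ 2 := by
    -- Since B = W - ηA, the 2 controls B² and 3/η² more than controls A².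
    refine ⟨min κ₀ g / 2 / (2 + 3 / η ^ 2), by positivity, fun A B => ?_⟩
    have h1 : A ^ 2 + B ^ 2 ≤ (2 + 3 / η ^ 2) * ((η * A + B) ^ 2 + (η * A) ^ 2) := by
      have e : A ^ 2 = (η * A) ^ 2 / η ^ 2 := by field_simp
      have e2 : (2 + 3 / η ^ 2) * ((η * A + B) ^ 2 + (η * A) ^ 2) - (A ^ 2 + B ^ 2) =
        (η * A + B + η * A) ^ 2 + (3 * (η * A + B) ^ 2 + 2 * (η * A) ^ 2) / η ^ 2 := by
        rw [e]; ring
      have : 0 ≤ (η * A + B + η * A) ^ 2 + (3 * (η * A + B) ^ 2 + 2 * (η * A) ^ 2) / η ^ 2 := by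
        positivity
      linarith
    have h2 : min κ₀ g / 2 / (2 + 3 / η ^ 2) * (A ^ 2 + B ^ 2) ≤
        min κ₀ g / 2 * ((η * A + B) ^ 2 + (η * A) ^ 2) := by
      rw [div_mul_eq_mul_div, div_le_iff₀ (by positivity), mul_assoc, mul_comm _ (2 + 3 / η ^ 2)]
      exact mul_le_mul_of_nonneg_left h1 (by positivity)
    have h3 := mul_le_mul_of_nonneg_right (min_le_left κ₀ g) (sq_nonneg (η * A + B))
    have h4 := mul_le_mul_of_nonneg_right (min_le_right κ₀ g) (sq_nonneg (η * A))
    linarith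
  obtain ⟨δ', hδ'0, hδ'⟩ : ∃ δ : ℝ, 0 < δ ∧ ∀ A B : ℝ, δ * (A ^ 2 + B ^ 2) ≤
      (η * A + B) ^ 2 / 2 + B ^ 2 / 2 := by
    refine ⟨1 / 2 / (2 + 3 / η ^ 2), by positivity, fun A B => ?_⟩
    rw [div_mul_eq_mul_div, div_le_iff₀ (by positivity)]
    have e : A ^ 2 = (η * A) ^ 2 / η ^ 2 := by field_simp
    have e2 : ((η * A + B) ^ 2 / 2 + B ^ 2 / 2) * (2 + 3 / η ^ 2) - 1 / 2 * (A ^ 2 + B ^ 2) =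
        (η * A + B) ^ 2 + B ^ 2 / 2 + ((η * A + B + B) ^ 2 + (η * A + B) ^ 2 + B ^ 2) / (2 * η ^ 2)
          := by rw [e]; field_simp; ring
    have : 0 ≤ (η * A + B) ^ 2 + B ^ 2 / 2 + ((η * A + B + B) ^ 2 + (η * A + B) ^ 2 + B ^ 2) / (2 * η ^ 2) := by
      positivity
    linarith
  set K := η ^ 2 + 2 + M * (ρ / Real.pi ^ 2 + lam / G) with hK
  have hK0 : 0 < K := by positivity
  refine ⟨δ / K, K / δ', by positivity, by positivity, fun m A B hm hA hB hA' hB' t ht => ?_⟩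
  have hm0 : 0 < m := hπ.trans_le hm
  -- The B²/2 term cancels the cross term gWB in the derivative of W²/2. The last term is M times
  -- the mode's energy, as A/m is up to sign the velocity coefficient.
  set V : ℝ → ℝ := fun t => (η * A t + B t) ^ 2 / 2 + B t ^ 2 / 2 +
    M * ((ρ / m ^ 2 * A t ^ 2 + lam / G * B t ^ 2) / 2) with hV
  have hlow : ∀ s, δ' * (A s ^ 2 + B s ^ 2) ≤ V s := fun s => by
    have : 0 ≤ M * ((ρ / m ^ 2 * A s ^ 2 + lam / G * B s ^ 2) / 2) := by positivity
    have := hδ' (A s) (B s)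
    simp only [hV]
    linarith
  have hup : ∀ s, V s ≤ K * (A s ^ 2 + B s ^ 2) := fun s => by
    -- This is where m ≥ π makes the upper bound on V independent of the mode.
    have h1 : ρ / m ^ 2 ≤ ρ / Real.pi ^ 2 := by gcongr
    have h2 : ρ / m ^ 2 * A s ^ 2 ≤ ρ / Real.pi ^ 2 * A s ^ 2 :=
      mul_le_mul_of_nonneg_right h1 (sq_nonneg _)
    have h3 : 0 ≤ ρ / Real.pi ^ 2 * B s ^ 2 := by positivity
    have h3' : 0 ≤ ρ / Real.pi ^ 2 * A s ^ 2 := by positivity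
    have h4 : 0 ≤ lam / G * A s ^ 2 := by positivity
    have h4' : 0 ≤ lam / G * B s ^ 2 := by positivity
    have h5 : M * ((ρ / m ^ 2 * A s ^ 2 + lam / G * B s ^ 2) / 2) ≤
        M * ((ρ / Real.pi ^ 2 + lam / G) * (A s ^ 2 + B s ^ 2)) :=
      mul_le_mul_of_nonneg_left (by linarith) hM0.le
    have h6 : (η * A s + B s) ^ 2 / 2 + B s ^ 2 / 2 ≤ (η ^ 2 + 2) * (A s ^ 2 + B s ^ 2) := by
      nlinarith [sq_nonneg (η * A s - B s), sq_nonneg (η * B s), sq_nonneg (A s), sq_nonneg (B s)]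
    simp only [hV, hK]
    linarith
  have hVc : ContinuousOn V (Ici 0) := by
    simp only [hV]
    fun_prop
  have hVd : ∀ s, 0 < s → HasDerivAt V
      (-(m ^ 2 * η / ρ) * (η * A s + B s) ^ 2 + g * (η * A s + B s) ^ 2 - g * B s ^ 2
        - g * (N + 1) * (η * A s) ^ 2) s := fun s hs => by
    have a := hA' s hs
    have b := hB' s hs
    have := (((((a.const_mul η).add b).pow 2).div_const 2).add ((b.pow 2).div_const 2)).add
      (((((a.pow 2).const_mul (ρ / m ^ 2)).add ((b.pow 2).const_mul (lam / G))).div_const 2).const_mul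
        M)
    refine this.congr_deriv ?_
    rw [hM, hg]
    simp only [Pi.add_apply]
    field_simp
    ring
  have hdec := le_exp_mul_of_deriv_le (c := δ / K) hVc hVd (fun s hs => by
    have hκ : κ₀ ≤ m ^ 2 * η / ρ := by rw [hκ₀]; gcongr
    have h1 := lyapunov_rate (W := η * A s + B s) (B := B s) hg0 hκ0 hκ hN
    simp only [add_sub_cancel_right] at h1
    have h2 := hδ (A s) (B s)
    have h3 : δ / K * V s ≤ δ * (A s ^ 2 + B s ^ 2) := by
      rw [div_mul_eq_mul_div, div_le_iff₀ hK0]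
      have := mul_le_mul_of_nonneg_left (hup s) hδ0.le
      linarith
    linarith) ht
  have h1 := (hlow t).trans (hdec.trans (mul_le_mul_of_nonneg_left (hup 0) (Real.exp_pos _).le))
  rw [div_mul_eq_mul_div, div_mul_eq_mul_div, le_div_iff₀ hδ'0]
  linarith

/-! ### Fourier coefficients of H¹ functions and their weak derivatives. -/

theorem H1.continuous_fn : Continuous H1.fn :=
  (WithLp.fstL 2 ℝ L2 L2).continuous.comp continuous_subtype_val

theorem H1.continuous_dy : Continuous H1.dy :=
  (WithLp.sndL 2 ℝ L2 L2).continuous.comp continuous_subtype_val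

theorem H1.norm_sq_eq (f : H1) : ‖f‖ ^ 2 = ‖f.fn‖ ^ 2 + ‖f.dy‖ ^ 2 :=
  WithLp.prod_norm_sq_eq_of_L2 (f : WithLp 2 (L2 × L2))

theorem H2.memLp_dyy {v : ℝ → H2} {μ : Measure ℝ} (hv : MemLp v 2 μ) :
    MemLp (fun t => (v t).dyy) 2 μ :=
  hv.of_le (((WithLp.prod_continuous_ofLp 2 H1 L2).snd.comp
    continuous_subtype_val).comp_aestronglyMeasurable hv.1)
    (Filter.Eventually.of_forall fun t => by
      refine (pow_le_pow_iff_left₀ (norm_nonneg _) (norm_nonneg _) two_ne_zero).1 ?_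
      have : ‖v t‖ ^ 2 = ‖(v t).toH1‖ ^ 2 + ‖(v t).dyy‖ ^ 2 :=
        WithLp.prod_norm_sq_eq_of_L2 (v t : WithLp 2 (H1 × L2))
      exact (le_add_of_nonneg_left (sq_nonneg _)).trans_eq this.symm)

theorem hasDerivAt_cosC (k : ℕ) (y : ℝ) :
    HasDerivAt (cosC k) (-(k * Real.pi) * sinC k y) y := by
  have := (Real.hasDerivAt_cos (k * Real.pi * y)).comp y
    ((hasDerivAt_id y).const_mul (k * Real.pi : ℝ))
  refine this.congr_deriv ?_
  simp only [sinC, ContinuousMap.coe_mk]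
  ring

theorem hasDerivAt_sinC (k : ℕ) (y : ℝ) :
    HasDerivAt (sinC k) (k * Real.pi * cosC k y) y := by
  have := (Real.hasDerivAt_sin (k * Real.pi * y)).comp y
    ((hasDerivAt_id y).const_mul (k * Real.pi : ℝ))
  refine this.congr_deriv ?_
  simp only [cosC, ContinuousMap.coe_mk]
  ring

theorem contDiff_cosC (k : ℕ) : ContDiff ℝ 1 (cosC k) := by
  change ContDiff ℝ 1 fun y => Real.cos (k * Real.pi * y)
  fun_prop

theorem contDiff_sinC (k : ℕ) : ContDiff ℝ 1 (sinC k) := by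
  change ContDiff ℝ 1 fun y => Real.sin (k * Real.pi * y)
  fun_prop

/-- The sine coefficients of a weak derivative. -/
theorem IsWeakDeriv.inner_sinC {f g : L2} (h : IsWeakDeriv f g) (k : ℕ) :
    inner ℝ (contL2 (sinC k)) g = -(k * Real.pi) * inner ℝ (contL2 (cosC k)) f := by
  rw [inner_contL2, inner_contL2]
  have := H1.integral_dy_mul ⟨WithLp.toLp 2 (f, g), h⟩ (contDiff_sinC k) (by simp [sinC])
    (by simp [sinC, Real.sin_nat_mul_pi])
  refine this.trans ?_
  rw [neg_mul, ← integral_const_mul]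
  congr 2
  ext y
  rw [(hasDerivAt_sinC k y).deriv]
  change f y * _ = _
  ring

/-- The cosine coefficients of the derivative of a function vanishing on the boundary. -/
theorem H1.VanishesOnBoundary.inner_cosC {f : H1} (hf : f.VanishesOnBoundary) (k : ℕ) :
    inner ℝ (contL2 (cosC k)) f.dy = k * Real.pi * inner ℝ (contL2 (sinC k)) f.fn := by
  rw [inner_contL2, inner_contL2, hf.integral_dy_mul (contDiff_cosC k), ← integral_const_mul,
    ← integral_neg]
  congr 1
  ext y
  rw [(hasDerivAt_cosC k y).deriv]
  ring

theorem mean_eq_inner (f : L2) : mean f = inner ℝ (contL2 (cosC 0)) f := by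
  rw [inner_contL2, mean]
  simp [cosC]

theorem inner_subConst (k : ℕ) (f : L2) (c : ℝ) : inner ℝ (contL2 (cosC k)) (subConst f c) =
    inner ℝ (contL2 (cosC k)) f - c * inner ℝ (contL2 (cosC k)) (contL2 (cosC 0)) := by
  have : Lp.const 2 μΩ c = c • contL2 (cosC 0) := by
    refine Lp.ext ?_
    filter_upwards [Lp.coeFn_const 2 μΩ c, Lp.coeFn_smul c (contL2 (cosC 0)),
      coeFn_contL2 (cosC 0)] with y h1 h2 h3
    rw [h1, h2, Pi.smul_apply, h3]
    simp [cosC]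
  rw [subConst, this, inner_sub_right, inner_smul_right]

/-! ### Mode equations of a solution. -/

namespace IsSolution

variable {ρ η lam G : ℝ} {u τ : ℝ → H1}

theorem continuousOn_inner_dy (h : IsSolution ρ η lam G u τ) (e : L2) :
    ContinuousOn (fun t => inner ℝ e (u t).dy) (Ici 0) :=
  continuousOn_const.inner (H1.continuous_dy.comp_continuousOn h.continuousOn_u)

theorem continuousOn_inner_stress (h : IsSolution ρ η lam G u τ) (e : L2) :
    ContinuousOn (fun t => inner ℝ e (τ t).fn) (Ici 0) :=
  continuousOn_const.inner (H1.continuous_fn.comp_continuousOn h.continuousOn_τ)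

/-- The stress equation on a mode. -/
theorem inner_stress_eq (h : IsSolution ρ η lam G u τ) (hlam : 0 < lam) (e : L2) {t : ℝ}
    (ht : 0 ≤ t) : inner ℝ e (τ t).fn =
      inner ℝ e (τ 0).fn + ∫ s in (0 : ℝ)..t, G / lam * inner ℝ e (u s).dy := by
  have hdy := H1.continuous_dy.comp_continuousOn h.continuousOn_u
  have := h.stress.inner_eq ((H1.continuous_fn.comp_continuousOn h.continuousOn_τ).const_smul lam)
    (fun T _ => ((hdy.const_smul G).mono Icc_subset_Ici_self).integrableOn_Icc) e ht
  simp only [inner_smul_right, intervalIntegral.integral_const_mul] at this ⊢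
  field_simp
  linarith

/-- The momentum equation on a cosine mode of the velocity gradient. -/
theorem inner_dy_eq (h : IsSolution ρ η lam G u τ) (hρ : 0 < ρ) (k : ℕ) {t : ℝ} (ht : 0 ≤ t) :
    inner ℝ (contL2 (cosC k)) (u t).dy = inner ℝ (contL2 (cosC k)) (u 0).dy +
      ∫ s in (0 : ℝ)..t, -((k * Real.pi) ^ 2 / ρ) *
        (η * inner ℝ (contL2 (cosC k)) (u s).dy + inner ℝ (contL2 (cosC k)) (τ s).fn) := by
  obtain ⟨v, ⟨hv, hvu⟩, hw⟩ := h.momentum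
  have hint : ∀ T, 0 < T → IntegrableOn (fun t => η • (v t).dyy + (τ t).dy) (Icc 0 T) :=
    fun T hT => (((H2.memLp_dyy (hv T hT)).integrable (by norm_num)).smul η).add
      (((H1.continuous_dy.comp_continuousOn h.continuousOn_τ).mono
        Icc_subset_Ici_self).integrableOn_Icc)
  have := hw.inner_eq ((H1.continuous_fn.comp_continuousOn h.continuousOn_u).const_smul ρ) hint
    (contL2 (sinC k)) ht
  have hcongr : ∫ s in (0 : ℝ)..t, inner ℝ (contL2 (sinC k)) (η • (v s).dyy + (τ s).dy) =
      -(k * Real.pi) * ∫ s in (0 : ℝ)..t,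
        (η * inner ℝ (contL2 (cosC k)) (u s).dy + inner ℝ (contL2 (cosC k)) (τ s).fn) := by
    rw [← intervalIntegral.integral_const_mul]
    refine intervalIntegral.integral_congr_ae ?_
    -- The second derivative exists only for a.e. time, which suffices under the integral. Sine
    -- testing replaces it by quantities continuous in time.
    filter_upwards [(ae_restrict_iff' measurableSet_Ici).1 hvu] with s hs hst
    rw [uIoc_of_le ht] at hst
    have hdyy : IsWeakDeriv (u s).dy (v s).dyy := by
      rw [← hs (mem_Ici.2 hst.1.le)]
      exact (v s).2
    have hτ : IsWeakDeriv (τ s).fn (τ s).dy := (τ s).2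
    rw [inner_add_right, inner_smul_right, hdyy.inner_sinC, hτ.inner_sinC]
    ring
  rw [hcongr] at this
  simp only [inner_smul_right] at this
  -- The Dirichlet condition makes the gradient's cosine coefficient kπ times the velocity's sine
  -- coefficient, so the tested equation is scaled by kπ/ρ.
  rw [(h.boundary t ht).inner_cosC, (h.boundary 0 le_rfl).inner_cosC,
    intervalIntegral.integral_const_mul]
  field_simp
  linear_combination (k : ℝ) * this

theorem inner_dy_zero (h : IsSolution ρ η lam G u τ) {t : ℝ} (ht : 0 ≤ t) :
    inner ℝ (contL2 (cosC 0)) (u t).dy = 0 := by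
  simp [(h.boundary t ht).inner_cosC]

end IsSolution

/-! ### Summation over modes and conclusion. -/

/-- Decay of the velocity gradient and of the stress in `L²(Ω)`, at a uniform rate. -/
theorem exists_gradient_decay {ρ η lam G : ℝ} (hρ : 0 < ρ) (hη : 0 < η) (hlam : 0 < lam)
    (hG : 0 < G) : ∃ c K : ℝ, 0 < c ∧ 0 ≤ K ∧ ∀ u τ : ℝ → H1, IsSolution ρ η lam G u τ →
      ∀ t, 0 ≤ t → ‖(u t).dy‖ ^ 2 + ‖subConst (τ t).fn (mean (τ 0).fn)‖ ^ 2 ≤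
        K * Real.exp (-c * t) *
          (‖(u 0).dy‖ ^ 2 + ‖subConst (τ 0).fn (mean (τ 0).fn)‖ ^ 2) := by
  obtain ⟨c, K, hc, hK, hmode⟩ := exists_mode_decay hρ hη hlam hG
  refine ⟨c, K, hc, hK, fun u τ h t ht => norm_sq_add_le_of_inner_cosC fun k => ?_⟩
  simp only [inner_subConst]
  rcases k.eq_zero_or_pos with rfl | hk
  · have hst : inner ℝ (contL2 (cosC 0)) (τ t).fn = inner ℝ (contL2 (cosC 0)) (τ 0).fn := by
      rw [h.inner_stress_eq hlam _ ht, intervalIntegral.integral_congr (g := fun _ => (0 : ℝ))]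
      · simp
      · intro s hs
        rw [uIcc_of_le ht] at hs
        simp only [h.inner_dy_zero hs.1, mul_zero]
    have h1 : inner ℝ (contL2 (cosC 0)) (contL2 (cosC 0)) = 1 := by
      rw [inner_cosC]; norm_num
    rw [hst, h.inner_dy_zero ht, h.inner_dy_zero le_rfl, mean_eq_inner, h1]
    simp
  · simp only [inner_cosC_of_ne hk.ne', mul_zero, sub_zero]
    have hA := h.continuousOn_inner_dy (contL2 (cosC k))
    have hB := h.continuousOn_inner_stress (contL2 (cosC k))
    refine hmode (k * Real.pi) (fun t => inner ℝ (contL2 (cosC k)) (u t).dy)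
      (fun t => inner ℝ (contL2 (cosC k)) (τ t).fn)
      (le_mul_of_one_le_left Real.pi_pos.le (by exact_mod_cast hk)) hA hB ?_ ?_ t ht
    · exact fun s hs => hasDerivAt_of_integral_eq
        (continuousOn_const.mul ((continuousOn_const.mul hA).add hB))
        (fun r hr => h.inner_dy_eq hρ k hr) hs
    · exact fun s hs => hasDerivAt_of_integral_eq (continuousOn_const.mul hA)
        (fun r hr => h.inner_stress_eq hlam _ hr) hs

end CouetteFlow

theorem mainTheorem6 (ρ η lam G : ℝ) (hρ : 0 < ρ) (hη : 0 < η) (hlam : 0 < lam) (hG : 0 < G) :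
    ∃ C : ℝ, 0 < C ∧ ∀ u τ : ℝ → CouetteFlow.H1, CouetteFlow.IsSolution ρ η lam G u τ →
      ∃ C₀ t₀ : ℝ, 0 ≤ t₀ ∧ ∀ t : ℝ, t₀ ≤ t →
        ‖u t‖ + ‖CouetteFlow.subConst (τ t).fn (CouetteFlow.mean (τ 0).fn)‖
            ≤ C₀ * Real.exp (-C * t) ∧
        ‖(u t).dy‖ + ‖CouetteFlow.subConst (τ t).fn (CouetteFlow.mean (τ 0).fn)‖
            ≤ C₀ * Real.exp (-C * t) := by
  obtain ⟨c, K, hc, hK, hdec⟩ := CouetteFlow.exists_gradient_decay hρ hη hlam hG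
  -- Squared norms decay at rate c, hence norms at c/2.
  refine ⟨c / 2, by positivity, fun u τ h => ?_⟩
  set S := ‖(u 0).dy‖ ^ 2 + ‖CouetteFlow.subConst (τ 0).fn (CouetteFlow.mean (τ 0).fn)‖ ^ 2
  have hS : 0 ≤ K * S := by positivity
  refine ⟨2 * √(K * S), 0, le_rfl, fun t ht => ?_⟩
  have hd := hdec u τ h t ht
  have hP := (h.boundary t ht).norm_fn_le
  have hn := (u t).norm_sq_eq
  set Y := ‖CouetteFlow.subConst (τ t).fn (CouetteFlow.mean (τ 0).fn)‖
  have hY : 0 ≤ Y := norm_nonneg _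
  have hexp : Real.exp (-(c / 2) * t) ^ 2 = Real.exp (-c * t) := by
    rw [← Real.exp_nat_mul]
    congr 1
    push_cast
    ring
  have hP2 : ‖(u t).fn‖ ^ 2 ≤ ‖(u t).dy‖ ^ 2 := pow_le_pow_left₀ (norm_nonneg _) hP 2
  have hdy : ‖(u t).dy‖ ≤ ‖u t‖ :=
    (pow_le_pow_iff_left₀ (norm_nonneg _) (norm_nonneg _) two_ne_zero).1
      (by rw [hn]; linarith [sq_nonneg ‖(u t).fn‖])
  have main : ‖u t‖ + Y ≤ 2 * √(K * S) * Real.exp (-(c / 2) * t) := by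
    -- By Poincaré ‖u‖² ≤ 2‖∂_y u‖², so (‖u‖ + Y)² ≤ 2(‖u‖² + Y²) ≤ 4(‖∂_y u‖² + Y²); this explains
    -- the factor 2 in the constant.
    refine (pow_le_pow_iff_left₀ (by positivity) (by positivity) two_ne_zero).1 ?_
    rw [mul_pow, mul_pow, Real.sq_sqrt hS, hexp]
    linarith [sq_nonneg (‖u t‖ - Y), sq_nonneg Y]
  exact ⟨main, (add_le_add_left hdy Y).trans main⟩
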